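/- Let $G\subset GL(n,\mathbb R)$ be a Lie subgroup, not necessarily closed, with Lie algebra $\mathfrak g=\{A\in\mathfrak{gl}(n,\mathbb R) : \exp(tA)\in G \text{ for all } t\in\mathbb R\}$ (more generally, $G$ may be any subgroup, with $\mathfrak g$ defined by this formula). Let $M$ be a smooth $n$-dimensional manifold and let $P$ be a $G$-structure on $M$: at each point $x\in M$, $P_x$ (the set of adapted frames at $x$) is an orbit of the right action of $G$ on the linear frames of $T_xM$, and around each point of $M$ there is a smooth local frame all of whose values are adapted. Let $X_1,\dots,X_n$ be a smooth adapted local frame on an open set $U\subset M$, and let $\widetilde\nabla$ be the linear connection on $U$ defined by $\widetilde\nabla_{X_i}X_j=0$ for all $i,j$. Let $\nabla$ be any smooth linear connection on $U$, write $\nabla=\widetilde\nabla+\tau$ with $\tau$ a tensor field of type $(1,2)$, put $\tau(X_i,X_j)=\sum_k\tau_{ij}^kX_k$, and let $\tau_i(x)=(\tau_{ij}^k(x))\in\mathfrak{gl}(n,\mathbb R)$, $x \in U$, be the matrix with row index $k$ and column index $j$, that is, the matrix of the endomorphism $\tau(X_i,\cdot)$ of $T_xM$ in the frame $X_1,\dots,X_n$.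 Then $\nabla$ is a $G$-connection on $U$ (that is, for every smooth curve in $U$ the $\nabla$-parallel transport along it maps adapted frames into adapted frames) if and only if $\tau_i(x)\in\mathfrak g$ for all $i=1,\dots,n$ and all $x\in U$. -/

import Mathlib

open Set Module
open scoped Manifold ContDiff Topology Bundle

noncomputable section

namespace GStruct

/-- The Lie algebra of a Lie subgroup `G` of `GL(n, ℝ)`, as a subset of `𝔤𝔩(n, ℝ)`: the matrices
generating a one-parameter subgroup contained in `G`. -/
def lieAlgebra {n : ℕ} (G : Subgroup (GL (Fin n) ℝ)) : Set (Matrix (Fin n) (Fin n) ℝ) :=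
  {A | ∀ t : ℝ, ∃ g ∈ G, (g : Matrix (Fin n) (Fin n) ℝ) = NormedSpace.exp (t • A)}

/-- The right action of matrices on `n`-tuples of vectors:
`(z₁, …, zₙ) · a = (∑ₖ aₖ₁ zₖ, …, ∑ₖ aₖₙ zₖ)`. -/
def frameMul {n : ℕ} {V : Type*} [AddCommGroup V] [Module ℝ V]
    (z : Fin n → V) (a : Matrix (Fin n) (Fin n) ℝ) : Fin n → V :=
  fun j ↦ ∑ k, a k j • z k

/-- A `G`-structure on an `n`-manifold `M`: a reduction of the linear frame bundle to `G`. In each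
tangent space it selects an orbit, under the right action of `G`, of linear frames
(`n` linearly independent tangent vectors), and around each point there is a smooth
local frame consisting of selected frames. -/
structure GStructure {n : ℕ} (G : Subgroup (GL (Fin n) ℝ)) (M : Type*) [TopologicalSpace M]
    [ChartedSpace (EuclideanSpace ℝ (Fin n)) M] [IsManifold (𝓡 n) ∞ M] where
  /-- the adapted frames at a point -/
  adapted : ∀ x : M, Set (Fin n → TangentSpace (𝓡 n) x)
  linearIndependent : ∀ {x : M} {z : Fin n → TangentSpace (𝓡 n) x},
    z ∈ adapted x → LinearIndependent ℝ z
  mul_mem : ∀ {x : M} {z : Fin n → TangentSpace (𝓡 n) x} {a : GL (Fin n) ℝ},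
    z ∈ adapted x → a ∈ G → frameMul z (a : Matrix (Fin n) (Fin n) ℝ) ∈ adapted x
  exists_eq_mul : ∀ {x : M} {z z' : Fin n → TangentSpace (𝓡 n) x},
    z ∈ adapted x → z' ∈ adapted x →
      ∃ a ∈ G, z' = frameMul z (a : Matrix (Fin n) (Fin n) ℝ)
  exists_local_section : ∀ x : M, ∃ W : Set M, IsOpen W ∧ x ∈ W ∧
    ∃ s : Fin n → (y : M) → TangentSpace (𝓡 n) y,
      IsLocalFrameOn (𝓡 n) (EuclideanSpace ℝ (Fin n)) ∞ s W ∧ ∀ y ∈ W, (fun i ↦ s i y) ∈ adapted y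

variable {n : ℕ} {M : Type*} [TopologicalSpace M] [ChartedSpace (EuclideanSpace ℝ (Fin n)) M]

/-- An operator `∇` sending a vector field `σ` to the field `x ↦ (v ↦ (∇_v σ)(x))`. -/
abbrev ConnOp (n : ℕ) (M : Type*) [TopologicalSpace M]
    [ChartedSpace (EuclideanSpace ℝ (Fin n)) M] : Type _ :=
  ((x : M) → TangentSpace (𝓡 n) x) →
    (x : M) → TangentSpace (𝓡 n) x →L[ℝ] TangentSpace (𝓡 n) x

/-- A (smooth) linear connection on the open set `U`. -/
structure IsLinearConnectionOn [IsManifold (𝓡 n) ∞ M] (nabla : ConnOp n M) (U : Set M) : Prop where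
  isCovariantDerivativeOn : IsCovariantDerivativeOn (EuclideanSpace ℝ (Fin n)) nabla U
  smooth : ContMDiffCovariantDerivativeOn (EuclideanSpace ℝ (Fin n)) ∞ nabla U

/-- The velocity at time `t` of a curve `c` defined on the time interval `J`. -/
def velocityWithin (c : ℝ → M) (J : Set ℝ) (t : ℝ) : TangentSpace (𝓡 n) (c t) :=
  mfderivWithin 𝓘(ℝ, ℝ) (𝓡 n) c J t (1 : ℝ)

/-- `w` is the covariant derivative `(∇_{ċ} V)(t)` of the vector field `V` along the curve `c`
(with time interval `J`): if `V = ∑ⱼ vʲ eⱼ` along `c` near time `t`, where `(eⱼ)` is a smooth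
frame near `c t`, then
`(∇_{ċ} V)(t) = ∑ⱼ (v̇ʲ(t) eⱼ + vʲ(t) ∇_{ċ(t)} eⱼ)`. The result does not depend on the frame. -/
def HasCovDerivWithinAt [IsManifold (𝓡 n) ∞ M] (nabla : ConnOp n M) (c : ℝ → M)
    (V : (t : ℝ) → TangentSpace (𝓡 n) (c t)) (J : Set ℝ) (t : ℝ)
    (w : TangentSpace (𝓡 n) (c t)) : Prop :=
  ∃ (W : Set M) (e : Fin n → (y : M) → TangentSpace (𝓡 n) y) (v : Fin n → ℝ → ℝ) (v' : Fin n → ℝ),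
    IsOpen W ∧ c t ∈ W ∧ IsLocalFrameOn (𝓡 n) (EuclideanSpace ℝ (Fin n)) ∞ e W ∧
    (∀ᶠ r in 𝓝[J] t, V r = ∑ j, v j r • e j (c r)) ∧
    (∀ j, HasDerivWithinAt (v j) (v' j) J t) ∧
    w = ∑ j, (v' j • e j (c t) + v j t • nabla (e j) (c t) (velocityWithin c J t))

/-- `v'` is the parallel transport of `v` along the curve `c : [a, b] → M`: there is a parallel
vector field along `c` with initial value `v` and final value `v'`. -/
def IsParallelTransport [IsManifold (𝓡 n) ∞ M] (nabla : ConnOp n M) (c : ℝ → M) (a b : ℝ)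
    (v : TangentSpace (𝓡 n) (c a)) (v' : TangentSpace (𝓡 n) (c b)) : Prop :=
  ∃ V : (t : ℝ) → TangentSpace (𝓡 n) (c t), V a = v ∧ V b = v' ∧
    ∀ t ∈ Icc a b, HasCovDerivWithinAt nabla c V (Icc a b) t 0

/-- `∇` is a `G`-connection on `U` for the `G`-structure `P`: parallel transport along
smooth curves in `U` maps adapted frames into adapted frames. -/
def IsGConnectionOn [IsManifold (𝓡 n) ∞ M] {G : Subgroup (GL (Fin n) ℝ)} (P : GStructure G M)
    (nabla : ConnOp n M) (U : Set M) : Prop :=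
  ∀ (c : ℝ → M) (a b : ℝ), a < b → ContMDiffOn 𝓘(ℝ, ℝ) (𝓡 n) ∞ c (Icc a b) →
    MapsTo c (Icc a b) U →
    ∀ (z : Fin n → TangentSpace (𝓡 n) (c a)) (z' : Fin n → TangentSpace (𝓡 n) (c b)),
      z ∈ P.adapted (c a) → (∀ i, IsParallelTransport nabla c a b (z i) (z' i)) →
        z' ∈ P.adapted (c b)

/-! ### The connection of a local parallelism -/

variable {X : Fin n → (x : M) → TangentSpace (𝓡 n) x} {U : Set M}

/-- The coefficients, in a smooth local frame, of a vector field differentiable at a point are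
differentiable there. -/
theorem mdifferentiableAt_coeff [IsManifold (𝓡 n) ∞ M]
    (hX : IsLocalFrameOn (𝓡 n) (EuclideanSpace ℝ (Fin n)) ∞ X U) (hU : IsOpen U)
    {σ : (x : M) → TangentSpace (𝓡 n) x} {x : M} (hx : x ∈ U)
    (hσ : MDifferentiableAt (𝓡 n) ((𝓡 n).prod 𝓘(ℝ, EuclideanSpace ℝ (Fin n)))
      (fun y ↦ (⟨y, σ y⟩ : Bundle.TotalSpace (EuclideanSpace ℝ (Fin n)) (TangentSpace (𝓡 n) (M := M)))) x)
    (i : Fin n) :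
    MDifferentiableAt (𝓡 n) 𝓘(ℝ, ℝ) (fun y ↦ hX.coeff i y (σ y)) x := by
  set e := trivializationAt (EuclideanSpace ℝ (Fin n)) (TangentSpace (𝓡 n) (M := M)) x with he
  have hxe : x ∈ e.baseSet := FiberBundle.mem_baseSet_trivializationAt' x
  let s : Fin n → M → EuclideanSpace ℝ (Fin n) := fun j y ↦ (e ⟨y, X j y⟩).2
  let q : M → EuclideanSpace ℝ (Fin n) := fun y ↦ (e ⟨y, σ y⟩).2
  have hs : ∀ j, ContMDiffAt (𝓡 n) 𝓘(ℝ, EuclideanSpace ℝ (Fin n)) 1 (s j) x := fun j ↦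
    (e.contMDiffAt_section_iff hxe).1 ((hX.contMDiffAt hU hx j).of_le (by simp))
  have hq : MDifferentiableAt (𝓡 n) 𝓘(ℝ, EuclideanSpace ℝ (Fin n)) q x :=
    (e.mdifferentiableAt_section_iff _ _ hxe).1 hσ
  let K : (Fin n → EuclideanSpace ℝ (Fin n)) →L[ℝ] ((Fin n → ℝ) →L[ℝ] EuclideanSpace ℝ (Fin n)) :=
    ∑ j, (ContinuousLinearMap.smulRightL ℝ (Fin n → ℝ) (EuclideanSpace ℝ (Fin n))
      (ContinuousLinearMap.proj j)).comp (ContinuousLinearMap.proj j)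
  have hK : ∀ (p : Fin n → EuclideanSpace ℝ (Fin n)) (f : Fin n → ℝ),
      K p f = ∑ j, f j • p j := by
    intro p f
    simp [K]
  let L : M → ((Fin n → ℝ) →L[ℝ] EuclideanSpace ℝ (Fin n)) := fun y ↦ K (fun j ↦ s j y)
  have hs' : MDifferentiableAt (𝓡 n) 𝓘(ℝ, Fin n → EuclideanSpace ℝ (Fin n))
      (fun y j ↦ s j y) x :=
    (contMDiffAt_pi_space.2 hs).mdifferentiableAt one_ne_zero
  have hL : MDifferentiableAt (𝓡 n) 𝓘(ℝ, (Fin n → ℝ) →L[ℝ] EuclideanSpace ℝ (Fin n)) L x :=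
    (K.differentiableAt.mdifferentiableAt).comp x hs'
  -- the frame matrix at a point of `U ∩ e.baseSet` is invertible
  have hinv : ∀ y ∈ U ∩ e.baseSet, ∃ A : (Fin n → ℝ) ≃L[ℝ] EuclideanSpace ℝ (Fin n),
      (A : (Fin n → ℝ) →L[ℝ] EuclideanSpace ℝ (Fin n)) = L y := by
    intro y hy
    let φ := e.linearEquivAt ℝ y hy.2
    let A := (((hX.toBasisAt hy.1).equivFun.symm).trans φ).toContinuousLinearEquiv
    refine ⟨A, ?_⟩
    ext1 f
    change φ ((hX.toBasisAt hy.1).equivFun.symm f) = K (fun j ↦ s j y) f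
    rw [hK, Basis.equivFun_symm_apply, map_sum]
    refine Finset.sum_congr rfl fun j _ ↦ ?_
    rw [map_smul, hX.toBasisAt_coe]
    rfl
  have hLinv : MDifferentiableAt (𝓡 n) 𝓘(ℝ, EuclideanSpace ℝ (Fin n) →L[ℝ] (Fin n → ℝ))
      (fun y ↦ ContinuousLinearMap.inverse (L y)) x := by
    obtain ⟨A, hA⟩ := hinv x ⟨hx, hxe⟩
    have h1 : DifferentiableAt ℝ ContinuousLinearMap.inverse (L x) := by
      rw [← hA]
      exact (contDiffAt_map_inverse (n := 1) A).differentiableAt (by simp)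
    exact h1.mdifferentiableAt.comp x hL
  have hfin : MDifferentiableAt (𝓡 n) 𝓘(ℝ, ℝ)
      (fun y ↦ ContinuousLinearMap.inverse (L y) (q y) i) x :=
    ((ContinuousLinearMap.proj (R := ℝ) (φ := fun _ : Fin n ↦ ℝ)
      i).differentiableAt.mdifferentiableAt).comp x (hLinv.clm_apply hq)
  refine hfin.congr_of_eventuallyEq ?_
  filter_upwards [(hU.inter e.open_baseSet).mem_nhds ⟨hx, hxe⟩] with y hy
  obtain ⟨A, hA⟩ := hinv y hy
  have hq' : q y = A (fun j ↦ hX.coeff j y (σ y)) := by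
    change q y = (A : (Fin n → ℝ) →L[ℝ] EuclideanSpace ℝ (Fin n)) _
    rw [hA]
    change _ = K (fun j ↦ s j y) _
    rw [hK]
    have := congrArg (e.linearEquivAt ℝ y hy.2) (hX.coeff_sum_eq σ hy.1)
    rw [map_sum] at this
    refine Eq.trans this (Finset.sum_congr rfl fun j _ ↦ ?_)
    rw [map_smul]
    rfl
  rw [← hA, ContinuousLinearMap.inverse_equiv, hq']
  simp

/-- The linear connection `∇̃` on `U` defined by the local parallelism `X₁, …, Xₙ`, that is, by
`∇̃_{Xᵢ} Xⱼ = 0`: for `σ = ∑ⱼ σʲ Xⱼ` one has `∇̃_v σ = ∑ⱼ dσʲ(v) Xⱼ`. -/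
def parallelismConn [IsManifold (𝓡 n) ∞ M]
    (hX : IsLocalFrameOn (𝓡 n) (EuclideanSpace ℝ (Fin n)) ∞ X U) : ConnOp n M :=
  fun σ x ↦ ∑ j, (mvfderiv (𝓡 n) (fun y ↦ hX.coeff j y (σ y)) x).smulRight (X j x)

theorem parallelismConn_isCovariantDerivativeOn [IsManifold (𝓡 n) ∞ M]
    (hX : IsLocalFrameOn (𝓡 n) (EuclideanSpace ℝ (Fin n)) ∞ X U) (hU : IsOpen U) :
    IsCovariantDerivativeOn (EuclideanSpace ℝ (Fin n)) (parallelismConn hX) U where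
  add := by
    intro σ σ' x hσ hσ' hx
    simp only [parallelismConn, ← Finset.sum_add_distrib]
    refine Finset.sum_congr rfl fun j _ ↦ ?_
    have h : (fun y ↦ hX.coeff j y ((σ + σ') y)) =
        (fun y ↦ hX.coeff j y (σ y)) + fun y ↦ hX.coeff j y (σ' y) := by
      ext y
      simp
    rw [h, mvfderiv_add (mdifferentiableAt_coeff hX hU hx hσ j)
      (mdifferentiableAt_coeff hX hU hx hσ' j)]
    ext v
    simp [add_smul]
  leibniz := by
    intro σ g x hσ hg hx
    ext1 v
    have h : ∀ j, (fun y ↦ hX.coeff j y ((g • σ) y)) = g • fun y ↦ hX.coeff j y (σ y) := by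
      intro j
      ext y
      simp
    have hv : ∀ j, mvfderiv (𝓡 n) (fun y ↦ hX.coeff j y ((g • σ) y)) x v =
        g x * mvfderiv (𝓡 n) (fun y ↦ hX.coeff j y (σ y)) x v +
          mvfderiv (𝓡 n) g x v * hX.coeff j x (σ x) := by
      intro j
      rw [h j, mvfderiv_smul hg (mdifferentiableAt_coeff hX hU hx hσ j)]
      simp
    have hsum := hX.coeff_sum_eq σ hx
    change (parallelismConn hX (g • σ) x) v = g x • (parallelismConn hX σ x) v +
      mvfderiv (𝓡 n) g x v • σ x
    rw [hsum]
    simp only [parallelismConn, sum_apply,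
      ContinuousLinearMap.smulRight_apply, hv, add_smul, Finset.sum_add_distrib, Finset.smul_sum,
      smul_smul]

theorem parallelismConn_frame [IsManifold (𝓡 n) ∞ M]
    (hX : IsLocalFrameOn (𝓡 n) (EuclideanSpace ℝ (Fin n)) ∞ X U) (hU : IsOpen U)
    (j : Fin n) {x : M} (hx : x ∈ U) : parallelismConn hX (X j) x = 0 := by
  refine Finset.sum_eq_zero fun k _ ↦ ?_
  have h : (fun y ↦ hX.coeff k y (X j y)) =ᶠ[𝓝 x] fun _ ↦ if j = k then (1 : ℝ) else 0 := by
    filter_upwards [hU.mem_nhds hx] with y hy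
    rw [hX.coeff_apply_of_mem hy, ← hX.toBasisAt_coe hy j, Basis.repr_self, Finsupp.single_apply]
  have h0 : mvfderiv (𝓡 n) (fun y ↦ hX.coeff k y (X j y)) x = 0 := by
    rw [mvfderiv, h.mfderiv_eq]
    exact mvfderiv_const _
  rw [h0]
  ext v
  simp

/-- The tensor field `τ = ∇ - ∇̃` of type `(1,2)` on `U`; `tau x v w = τ(v, w)` is
`∇_v Y - ∇̃_v Y` for any vector field `Y` with `Y x = w`. -/
def tau [IsManifold (𝓡 n) ∞ M] (hX : IsLocalFrameOn (𝓡 n) (EuclideanSpace ℝ (Fin n)) ∞ X U)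
    (hU : IsOpen U) {nabla : ConnOp n M} (hnabla : IsLinearConnectionOn nabla U)
    (x : M) (v w : TangentSpace (𝓡 n) x) : TangentSpace (𝓡 n) x :=
  hnabla.isCovariantDerivativeOn.difference (parallelismConn_isCovariantDerivativeOn hX hU) x w v

/-- The matrix `τᵢ(x) = (τᵢⱼᵏ(x))`, where `τ(Xᵢ, Xⱼ) = ∑ₖ τᵢⱼᵏ Xₖ`, with row index `k` and column
index `j`: the matrix of the endomorphism `τ(Xᵢ, ·)` in the frame `X₁, …, Xₙ`. -/
def tauMatrix [IsManifold (𝓡 n) ∞ M]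
    (hX : IsLocalFrameOn (𝓡 n) (EuclideanSpace ℝ (Fin n)) ∞ X U)
    (hU : IsOpen U) {nabla : ConnOp n M} (hnabla : IsLinearConnectionOn nabla U)
    (i : Fin n) (x : M) : Matrix (Fin n) (Fin n) ℝ :=
  Matrix.of fun k j ↦ hX.coeff k x (tau hX hU hnabla x (X i x) (X j x))

end GStruct

end

noncomputable section

namespace GStruct

/-! ### One-parameter families in a subgroup of the units of a finite-dimensional algebra -/

/-! In the frame `X`, the coefficient matrix `A` of a frame parallel along a curve `c` solves the
linear equation `A' = -T A`, where `T = ∑ᵢ ċⁱ τᵢ` is the matrix of `τ(ċ, ·)`. Since `X` is adapted,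
a frame with coefficient matrix `A` is adapted exactly when `A` lies in `G`. The theorem thus
compares the equation with the subgroup: solutions starting in `G` stay in `G` when the coefficients
are tangent to `G`, and the tangent directions can be read off from solutions known to lie in `G`.

As `G` need not be closed, no limit argument is available. The substitute is `tangentSubmodule`, the
initial velocities of `C²` curves in `G`, which is visibly a linear space. Multiplying such curves
along a basis gives a map `F` from this space into `G` with derivative the inclusion at `0`. By
translation, `dF(v) F⁻¹` is again tangent to `G` at every point, so `Y' = B Y` with `B` tangent to
`G` can be solved inside `G` by solving an equation for the parameter of `F`. Uniqueness and
connectedness of the interval then yield `solution_mem`. Applied to `exp (t • A)`, this identifies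
`tangentSubmodule` with the Lie algebra (`mem_tangentSubmodule_iff_exp`).

The condition on `τᵢ` implies the connection property by `solution_mem`. Conversely, transport along
a curve with initial velocity proportional to `Xᵢ` gives a `C²` curve in `G` whose velocity at `1`
is a nonzero multiple of `τᵢ(x)`. -/

/-- Local existence for the ODE `x' = h(x) B(s)`, with `h` of class `C¹` and `B` continuous. -/
theorem exists_local_solution {E E' : Type*} [NormedAddCommGroup E] [NormedSpace ℝ E]
    [CompleteSpace E] [NormedAddCommGroup E'] [NormedSpace ℝ E'] {h : E → E' →L[ℝ] E} {x₀ : E}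
    (hh : ContDiffAt ℝ 1 h x₀) {B : ℝ → E'} (hB : Continuous B) (s₀ : ℝ) :
    ∃ ε > 0, ∃ x : ℝ → E, x s₀ = x₀ ∧ ∀ s ∈ Icc (s₀ - ε) (s₀ + ε),
      HasDerivWithinAt x (h (x s) (B s)) (Icc (s₀ - ε) (s₀ + ε)) s := by
  obtain ⟨K, S, hS, hK⟩ := hh.exists_lipschitzOnWith
  obtain ⟨C, hC⟩ := (isCompact_Icc (a := s₀ - 1) (b := s₀ + 1)).exists_bound_of_continuousOn
    hB.continuousOn
  have hC0 : 0 ≤ C := (norm_nonneg _).trans (hC s₀ (by constructor <;> linarith))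
  have hbd : ∀ᶠ x in 𝓝 x₀, ‖h x‖ < ‖h x₀‖ + 1 :=
    hh.continuousAt.norm.eventually_lt continuousAt_const (by linarith)
  obtain ⟨r, hr, hrS⟩ := Metric.nhds_basis_closedBall.mem_iff.1 (Filter.inter_mem hS hbd)
  -- `D` bounds the speed on the ball of radius `r`. The time `ε` is at most `1`, where the bound on
  -- `B` holds, and small enough that `D * ε ≤ r`; the denominator `D + 1` allows `D = 0`.
  set D : ℝ := (‖h x₀‖ + 1) * C with hD
  have hD0 : 0 ≤ D := by positivity
  set ε : ℝ := min 1 (r / (D + 1)) with hε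
  have hε0 : 0 < ε := lt_min one_pos (by positivity)
  have hε1 : ε ≤ 1 := min_le_left _ _
  have hsub : ∀ s ∈ Icc (s₀ - ε) (s₀ + ε), ‖B s‖ ≤ C := fun s hs ↦
    hC s ⟨by linarith [hs.1], by linarith [hs.2]⟩
  refine ⟨ε, hε0, ?_⟩
  have hpl : IsPicardLindelof (fun s x ↦ h x (B s)) (tmin := s₀ - ε) (tmax := s₀ + ε)
      ⟨s₀, by constructor <;> linarith⟩ x₀ ⟨r, hr.le⟩ 0 ⟨D, hD0⟩ (K * ⟨C, hC0⟩) := by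
    refine ⟨fun s hs ↦ ?_, fun x _ ↦ ?_, fun s hs x hx ↦ ?_, ?_⟩
    · refine LipschitzOnWith.of_dist_le_mul fun x hx y hy ↦ ?_
      have h1 := hK.dist_le_mul x (hrS hx).1 y (hrS hy).1
      rw [dist_eq_norm] at h1 ⊢
      calc ‖h x (B s) - h y (B s)‖ = ‖(h x - h y) (B s)‖ := by simp
        _ ≤ ‖h x - h y‖ * ‖B s‖ := ContinuousLinearMap.le_opNorm _ _
        _ ≤ (K * dist x y) * C := by gcongr; exact hsub s hs
        _ = (K * C) * dist x y := by ring
    · exact ((h x).continuous.comp hB).continuousOn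
    · calc ‖h x (B s)‖ ≤ ‖h x‖ * ‖B s‖ := ContinuousLinearMap.le_opNorm _ _
        _ ≤ (‖h x₀‖ + 1) * C := by gcongr; exacts [(hrS hx).2.le, hsub s hs]
    · simp only [add_sub_cancel_left, sub_sub_cancel, max_self, NNReal.coe_zero,
        sub_zero]
      calc D * ε ≤ D * (r / (D + 1)) := by gcongr; exact min_le_right _ _
        _ = r * (D / (D + 1)) := by ring
        _ ≤ r * 1 := by gcongr; rw [div_le_one (by positivity)]; linarith
        _ = r := mul_one r
  exact hpl.exists_eq_forall_mem_Icc_hasDerivWithinAt₀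

variable {𝔸 : Type*} [NormedRing 𝔸] [NormedAlgebra ℝ 𝔸]

/-- The vectors tangent at `1` to twice continuously differentiable curves in `G`. -/
def tangentSubmodule (G : Subgroup 𝔸ˣ) : Submodule ℝ 𝔸 where
  -- Two derivatives are required so that the differential of a parametrization built from such
  -- curves is `C¹`, hence locally Lipschitz, as Picard–Lindelöf needs.
  carrier := {A | ∃ g : ℝ → 𝔸, ContDiff ℝ 2 g ∧ (∀ t, ∃ u ∈ G, (u : 𝔸) = g t) ∧ g 0 = 1 ∧
    HasDerivAt g A 0}
  zero_mem' := ⟨fun _ ↦ 1, contDiff_const, fun _ ↦ ⟨1, G.one_mem, rfl⟩, rfl, hasDerivAt_const _ _⟩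
  add_mem' := by
    rintro A A' ⟨g, hg, hG, h1, hd⟩ ⟨g', hg', hG', h1', hd'⟩
    refine ⟨fun t ↦ g t * g' t, hg.mul hg', fun t ↦ ?_, by simp [h1, h1'], ?_⟩
    · obtain ⟨u, hu, hut⟩ := hG t
      obtain ⟨u', hu', hut'⟩ := hG' t
      exact ⟨u * u', G.mul_mem hu hu', by simp [hut, hut']⟩
    · have h2 := hd.mul hd'
      simp only [h1, h1', mul_one, one_mul] at h2
      exact h2
  smul_mem' := by
    rintro r A ⟨g, hg, hG, h1, hd⟩
    refine ⟨fun t ↦ g (r * t), by fun_prop, fun t ↦ hG _, by simpa using h1, ?_⟩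
    have h2 : HasDerivAt (fun t : ℝ ↦ r * t) r 0 := by
      simpa using (hasDerivAt_id (0 : ℝ)).const_mul r
    have h3 : HasDerivAt g A (r * 0) := by simpa using hd
    exact h3.scomp 0 h2

/-- A sum of rank one maps with values in the tangent space of `G` is the derivative at `0` of a
map into `G`. -/
theorem exists_map_hasFDerivAt_sum {E ι : Type*} [NormedAddCommGroup E] [NormedSpace ℝ E]
    {G : Subgroup 𝔸ˣ} (φ : ι → E →L[ℝ] ℝ) (A : ι → 𝔸) (hA : ∀ i, A i ∈ tangentSubmodule G)
    (s : Finset ι) :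
    ∃ F : E → 𝔸, ContDiff ℝ 2 F ∧ (∀ x, ∃ u ∈ G, (u : 𝔸) = F x) ∧ F 0 = 1 ∧
      HasFDerivAt F (∑ i ∈ s, (φ i).smulRight (A i)) 0 := by
  classical
  induction s using Finset.induction_on with
  | empty =>
    exact ⟨fun _ ↦ 1, contDiff_const, fun _ ↦ ⟨1, G.one_mem, rfl⟩, rfl,
      by simpa using hasFDerivAt_const (1 : 𝔸) (0 : E)⟩
  | insert i s hi ih =>
    obtain ⟨F, hF, hG, h1, hd⟩ := ih
    obtain ⟨g, hg, hG', h1', hd'⟩ := hA i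
    -- All factors equal `1` at the origin, so the product rule just adds the derivatives.
    refine ⟨fun x ↦ g (φ i x) * F x, (hg.comp (φ i).contDiff).mul hF, fun t ↦ ?_,
      by simp [h1, h1'], ?_⟩
    · obtain ⟨u, hu, hut⟩ := hG t
      obtain ⟨u', hu', hut'⟩ := hG' (φ i t)
      exact ⟨u' * u, G.mul_mem hu' hu, by simp [hut, hut']⟩
    · have h3 : HasDerivAt g (A i) (φ i 0) := by simpa using hd'
      have h4 := (h3.hasFDerivAt.comp (0 : E) (φ i).hasFDerivAt).mul' hd
      refine h4.congr_fderiv ?_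
      ext v
      simp [Finset.sum_insert hi, h1, h1', add_comm]

/-- The logarithmic derivative of a map into `G` takes its values in the tangent space. -/
theorem fderiv_mul_inv_mem {E : Type*} [NormedAddCommGroup E] [NormedSpace ℝ E]
    {G : Subgroup 𝔸ˣ} {F : E → 𝔸} (hF : ContDiff ℝ 2 F) (hG : ∀ x, ∃ u ∈ G, (u : 𝔸) = F x)
    (x v : E) : fderiv ℝ F x v * Ring.inverse (F x) ∈ tangentSubmodule G := by
  obtain ⟨u, hu, hux⟩ := hG x
  -- Right translation by `(F x)⁻¹` moves the curve `F (x + t • v)` to one through `1` without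
  -- leaving `G`.
  refine ⟨fun t ↦ F (x + t • v) * Ring.inverse (F x), ?_, fun t ↦ ?_, ?_, ?_⟩
  · exact (hF.comp (by fun_prop)).mul contDiff_const
  · obtain ⟨u', hu', hut'⟩ := hG (x + t • v)
    exact ⟨u' * u⁻¹, G.mul_mem hu' (G.inv_mem hu), by simp [← hut', ← hux]⟩
  · simp [← hux]
  · have h1 : HasDerivAt (fun t : ℝ ↦ x + t • v) v 0 := by
      simpa using ((hasDerivAt_id (0 : ℝ)).smul_const v).const_add x
    have h2 : HasFDerivAt F (fderiv ℝ F x) (x + (0 : ℝ) • v) := by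
      simpa using (hF.differentiable (by norm_num) x).hasFDerivAt
    exact (h2.comp_hasDerivAt 0 h1).mul_const _

variable [FiniteDimensional ℝ 𝔸]

/-- A local parametrization of `G` by its tangent space. -/
theorem exists_parametrization (G : Subgroup 𝔸ˣ) :
    ∃ F : tangentSubmodule G → 𝔸, ContDiff ℝ 2 F ∧ (∀ x, ∃ u ∈ G, (u : 𝔸) = F x) ∧ F 0 = 1 ∧
      HasFDerivAt F (tangentSubmodule G).subtypeL 0 := by
  let b := Module.finBasis ℝ (tangentSubmodule G)
  obtain ⟨F, h1, h2, h3, h4⟩ := exists_map_hasFDerivAt_sum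
    (fun i ↦ (b.coord i).toContinuousLinearMap) (fun i ↦ (b i : 𝔸)) (fun i ↦ (b i).2) Finset.univ
  refine ⟨F, h1, h2, h3, h4.congr_fderiv ?_⟩
  refine ContinuousLinearMap.ext fun v ↦ ?_
  have := congrArg (tangentSubmodule G).subtype (b.sum_repr v)
  rw [map_sum] at this
  rw [sum_apply]
  exact this

/-- Local solutions in `G` of `Y' = B Y`, for `B` with values in the tangent space of `G`. -/
theorem exists_local_solution_mem (G : Subgroup 𝔸ˣ) {B : ℝ → tangentSubmodule G}
    (hB : Continuous B) (s₀ : ℝ) :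
    ∃ ε > 0, ∃ Y : ℝ → 𝔸, Y s₀ = 1 ∧ (∀ s, ∃ u ∈ G, (u : 𝔸) = Y s) ∧
      ∀ s ∈ Icc (s₀ - ε) (s₀ + ε),
        HasDerivWithinAt Y (B s * Y s) (Icc (s₀ - ε) (s₀ + ε)) s := by
  have : CompleteSpace 𝔸 := FiniteDimensional.complete ℝ 𝔸
  obtain ⟨F, hF, hG, hF0, hF'⟩ := exists_parametrization G
  obtain ⟨P₀, hP₀⟩ := (tangentSubmodule G).subtype.exists_leftInverse_of_injective
    (Submodule.ker_subtype _)
  let P : 𝔸 →L[ℝ] tangentSubmodule G := P₀.toContinuousLinearMap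
  have hP : ∀ A (hA : A ∈ tangentSubmodule G), P A = ⟨A, hA⟩ := fun A hA ↦
    LinearMap.congr_fun hP₀ ⟨A, hA⟩
  -- `F (x s)` solves `Y' = B Y` exactly when `dF(x') F(x)⁻¹ = B`. The left side is `C x` applied to
  -- `x'`; the projection `P` loses nothing because the value is already tangent to `G`. As `C 0` is
  -- the identity, `C` is invertible nearby and the equation becomes `x' = (C x)⁻¹ B`.
  let C : tangentSubmodule G → (tangentSubmodule G →L[ℝ] tangentSubmodule G) := fun x ↦
    P.comp (((ContinuousLinearMap.mul ℝ 𝔸).flip (Ring.inverse (F x))).comp (fderiv ℝ F x))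
  have hCapply : ∀ x v, C x v = P (fderiv ℝ F x v * Ring.inverse (F x)) := fun x v ↦ rfl
  have hinv : ContDiff ℝ 1 fun x ↦ Ring.inverse (F x) := by
    rw [contDiff_iff_contDiffAt]
    intro x
    obtain ⟨u, hu, hux⟩ := hG x
    have h1 := contDiffAt_ringInverse (n := 1) ℝ u
    rw [hux] at h1
    exact h1.comp x (hF.contDiffAt.of_le (by norm_num))
  have hC : ContDiff ℝ 1 C := by
    have h1 : ContDiff ℝ 1 (fderiv ℝ F) := hF.fderiv_right (by norm_num)
    exact contDiff_const.clm_comp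
      (((ContinuousLinearMap.mul ℝ 𝔸).flip.contDiff.comp hinv).clm_comp h1)
  have hC0 : C 0 = ContinuousLinearEquiv.refl ℝ (tangentSubmodule G) := by
    ext1 v
    rw [hCapply, hF'.fderiv, hF0]
    simpa using hP v v.2
  have hCinv : ContDiffAt ℝ 1 (fun x ↦ ContinuousLinearMap.inverse (C x)) 0 := by
    have h1 := contDiffAt_map_inverse (n := 1)
      (ContinuousLinearEquiv.refl ℝ (tangentSubmodule G))
    rw [← hC0] at h1
    exact h1.comp 0 hC.contDiffAt
  obtain ⟨ε, hε, x, hx0, hx⟩ := exists_local_solution hCinv hB s₀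
  have hxc : ContinuousAt x s₀ :=
    ((hx s₀ (by constructor <;> linarith)).continuousWithinAt).continuousAt
      (Icc_mem_nhds (by linarith) (by linarith))
  have hev : ∀ᶠ s in 𝓝 s₀, C (x s) ∈ range
      ((↑) : (tangentSubmodule G ≃L[ℝ] tangentSubmodule G) →
        (tangentSubmodule G →L[ℝ] tangentSubmodule G)) := by
    refine (hC.continuous.continuousAt.comp hxc) ?_
    rw [Function.comp_apply, hx0, hC0]
    exact ContinuousLinearEquiv.nhds _
  obtain ⟨δ, hδ, hδs⟩ := Metric.nhds_basis_closedBall.mem_iff.1 hev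
  rw [Real.closedBall_eq_Icc] at hδs
  have hsub : Icc (s₀ - min ε δ) (s₀ + min ε δ) ⊆ Icc (s₀ - ε) (s₀ + ε) :=
    Icc_subset_Icc (by linarith [min_le_left ε δ]) (by linarith [min_le_left ε δ])
  refine ⟨min ε δ, lt_min hε hδ, fun s ↦ F (x s), by simp [hx0, hF0], fun s ↦ hG _, fun s hs ↦ ?_⟩
  have hsδ : s ∈ Icc (s₀ - δ) (s₀ + δ) :=
    ⟨by linarith [min_le_right ε δ, hs.1], by linarith [min_le_right ε δ, hs.2]⟩
  obtain ⟨A, hA⟩ : C (x s) ∈ range _ := hδs hsδ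
  have hd : HasFDerivAt F (fderiv ℝ F (x s)) (x s) :=
    (hF.differentiable (by norm_num) _).hasFDerivAt
  refine ((hd.comp_hasDerivWithinAt s (hx s (hsub hs))).mono hsub).congr_deriv ?_
  set w := ContinuousLinearMap.inverse (C (x s)) (B s) with hw
  have hCw : C (x s) w = B s := by
    rw [hw, ← hA]
    simp
  rw [hCapply, hP _ (fderiv_mul_inv_mem hF hG _ _)] at hCw
  rw [← hCw]
  obtain ⟨u, hu, hux⟩ := hG (x s)
  simp [← hux, mul_assoc]

/-- A solution of `A' = B A`, with `B` continuous with values in the tangent space of `G`, which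
starts in `G` stays in `G`. -/
theorem solution_mem {G : Subgroup 𝔸ˣ} {B A : ℝ → 𝔸} {a b : ℝ} (hab : a ≤ b)
    (hB : ContinuousOn B (Icc a b)) (hBG : ∀ t ∈ Icc a b, B t ∈ tangentSubmodule G)
    (hA : ∀ t ∈ Icc a b, HasDerivWithinAt A (B t * A t) (Icc a b) t)
    (ha : ∃ u ∈ G, (u : 𝔸) = A a) : ∃ u ∈ G, (u : 𝔸) = A b := by
  have : CompleteSpace 𝔸 := FiniteDimensional.complete ℝ 𝔸
  let B' : ℝ → tangentSubmodule G := IccExtend hab fun t ↦ ⟨B t, hBG t t.2⟩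
  have hB' : Continuous B' := (hB.domRestrict.subtype_mk _).Icc_extend'
  have hBB' : ∀ t ∈ Icc a b, (B' t : 𝔸) = B t := fun t ht ↦ by simp [B', IccExtend_of_mem _ _ ht]
  -- Being both in `G` or both outside `G` is an equivalence relation on times. It is enough to
  -- relate each time to all nearby ones, so closedness of `G` plays no role.
  have key := isPreconnected_Icc.induction₂ (s := Icc a b)
    (fun s t ↦ (∃ u ∈ G, (u : 𝔸) = A s) ↔ ∃ u ∈ G, (u : 𝔸) = A t) ?_
    (fun _ _ _ _ _ _ h1 h2 ↦ h1.trans h2) (fun _ _ _ _ h ↦ h.symm) (left_mem_Icc.2 hab)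
    (right_mem_Icc.2 hab)
  · exact key.1 ha
  intro s₀ hs₀
  obtain ⟨ε, hε, Y, hY0, hYG, hY⟩ := exists_local_solution_mem G hB' s₀
  have hmem : Icc (s₀ - ε) (s₀ + ε) ∈ 𝓝 s₀ := Icc_mem_nhds (by linarith) (by linarith)
  set J := Icc a b ∩ Icc (s₀ - ε) (s₀ + ε) with hJ
  have hs₀J : s₀ ∈ J := ⟨hs₀, mem_of_mem_nhds hmem⟩
  -- `A` and `Y` solve the same linear equation, so `Y⁻¹ A` is constant and `A s = Y s * A s₀`. With
  -- `Y s` in `G`, membership of `A s` and of `A s₀` are equivalent.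
  have hconst : ∀ s ∈ J, Ring.inverse (Y s) * A s = A s₀ := by
    have hderiv : ∀ s ∈ J, HasDerivWithinAt (fun s ↦ Ring.inverse (Y s) * A s) 0 J s := by
      intro s hs
      obtain ⟨u, hu, hus⟩ := hYG s
      have h1 := hasFDerivAt_ringInverse (𝕜 := ℝ) u
      rw [hus] at h1
      have h2 : HasDerivWithinAt (fun s ↦ Ring.inverse (Y s))
          (-((↑u⁻¹ : 𝔸) * (B' s * Y s) * ↑u⁻¹)) J s :=
        h1.comp_hasDerivWithinAt s ((hY s hs.2).mono (inter_subset_right (s := Icc a b)))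
      have h3 := h2.mul ((hA s hs.1).mono (inter_subset_left (t := Icc (s₀ - ε) (s₀ + ε))))
      refine h3.congr_deriv ?_
      rw [hBB' s hs.1, ← hus, Ring.inverse_unit]
      simp [mul_assoc]
    have hconv : Convex ℝ J := (convex_Icc _ _).inter (convex_Icc _ _)
    intro s hs
    have := hconv.norm_image_sub_le_of_norm_hasDerivWithin_le (C := 0) hderiv (by simp) hs₀J hs
    simpa [hY0, sub_eq_zero] using this
  have hev : ∀ᶠ s in 𝓝[Icc a b] s₀, s ∈ J :=
    Filter.inter_mem self_mem_nhdsWithin (mem_nhdsWithin_of_mem_nhds hmem)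
  filter_upwards [hev] with s hs
  have h1 := hconst s hs
  obtain ⟨u, hu, hus⟩ := hYG s
  rw [← hus, Ring.inverse_unit] at h1
  constructor
  · rintro ⟨v, hv, hvs⟩
    refine ⟨u * v, G.mul_mem hu hv, ?_⟩
    rw [Units.val_mul, hvs, ← h1, Units.mul_inv_cancel_left]
  · rintro ⟨v, hv, hvs⟩
    refine ⟨u⁻¹ * v, G.mul_mem (G.inv_mem hu) hv, ?_⟩
    rw [Units.val_mul, hvs, h1]

/-- The tangent vectors of curves in `G` are the generators of one-parameter subgroups of `G`. -/
theorem mem_tangentSubmodule_iff_exp {G : Subgroup 𝔸ˣ} {A : 𝔸} :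
    A ∈ tangentSubmodule G ↔ ∀ t : ℝ, ∃ u ∈ G, (u : 𝔸) = NormedSpace.exp (t • A) := by
  have : CompleteSpace 𝔸 := FiniteDimensional.complete ℝ 𝔸
  constructor
  · have key : ∀ (A : 𝔸), A ∈ tangentSubmodule G → ∀ t : ℝ, 0 ≤ t →
        ∃ u ∈ G, (u : 𝔸) = NormedSpace.exp (t • A) := by
      intro A hA t ht
      refine solution_mem (A := fun t : ℝ ↦ NormedSpace.exp (t • A)) (B := fun _ ↦ A) ht
        continuousOn_const (fun _ _ ↦ hA)
        (fun s _ ↦ (hasDerivAt_exp_smul_const' (𝕂 := ℝ) A s).hasDerivWithinAt)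
        ⟨1, G.one_mem, by simp⟩
    intro hA t
    rcases le_total 0 t with ht | ht
    · exact key A hA t ht
    -- `solution_mem` only runs forward in time; negative `t` is reached through `-A`, which is
    -- tangent too.
    · simpa using key (-A) (Submodule.neg_mem _ hA) (-t) (by linarith)
  · intro h
    refine ⟨fun t : ℝ ↦ NormedSpace.exp (t • A), ?_, h, by simp, ?_⟩
    · have h1 : ContDiff ℝ 2 (NormedSpace.exp : 𝔸 → 𝔸) :=
        contDiff_iff_contDiffAt.2 fun x ↦ (NormedSpace.exp_analytic (𝕂 := ℝ) x).contDiffAt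
      exact h1.comp (by fun_prop)
    · simpa using hasDerivAt_exp_smul_const' (𝕂 := ℝ) A 0

/-! ### Coefficients in a smooth local frame -/

section coefficients

variable {n : ℕ} {M : Type*} [TopologicalSpace M] [ChartedSpace (EuclideanSpace ℝ (Fin n)) M]
  [IsManifold (𝓡 n) ∞ M] {X : Fin n → (x : M) → TangentSpace (𝓡 n) x} {U : Set M}

/-- The coefficient functions of a smooth local frame are smooth on the tangent bundle. -/
theorem contMDiffAt_coeff (hX : IsLocalFrameOn (𝓡 n) (EuclideanSpace ℝ (Fin n)) ∞ X U)
    (hU : IsOpen U) (p : TangentBundle (𝓡 n) M) (hp : p.1 ∈ U) (i : Fin n) :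
    ContMDiffAt ((𝓡 n).prod 𝓘(ℝ, EuclideanSpace ℝ (Fin n))) 𝓘(ℝ, ℝ) ∞
      (fun q : TangentBundle (𝓡 n) M ↦ hX.coeff i q.1 q.2) p := by
  obtain ⟨x, v⟩ := p
  replace hp : x ∈ U := hp
  set e := trivializationAt (EuclideanSpace ℝ (Fin n)) (TangentSpace (𝓡 n) (M := M)) x with he
  have hxe : x ∈ e.baseSet := FiberBundle.mem_baseSet_trivializationAt' x
  let s : Fin n → M → EuclideanSpace ℝ (Fin n) := fun j y ↦ (e ⟨y, X j y⟩).2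
  have hs : ∀ j, ContMDiffAt (𝓡 n) 𝓘(ℝ, EuclideanSpace ℝ (Fin n)) ∞ (s j) x := fun j ↦
    (e.contMDiffAt_section_iff hxe).1 (hX.contMDiffAt hU hp j)
  have hproj : ContMDiffAt ((𝓡 n).prod 𝓘(ℝ, EuclideanSpace ℝ (Fin n))) (𝓡 n) ∞
      (fun q : TangentBundle (𝓡 n) M ↦ q.1) ⟨x, v⟩ := Bundle.contMDiffAt_proj _
  have hq : ContMDiffAt ((𝓡 n).prod 𝓘(ℝ, EuclideanSpace ℝ (Fin n)))
      𝓘(ℝ, EuclideanSpace ℝ (Fin n)) ∞ (fun q : TangentBundle (𝓡 n) M ↦ (e q).2) ⟨x, v⟩ :=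
    (Bundle.contMDiffAt_totalSpace.1 (contMDiffAt_id (x := (⟨x, v⟩ : TangentBundle (𝓡 n) M)))).2
  let K : (Fin n → EuclideanSpace ℝ (Fin n)) →L[ℝ] ((Fin n → ℝ) →L[ℝ] EuclideanSpace ℝ (Fin n)) :=
    ∑ j, (ContinuousLinearMap.smulRightL ℝ (Fin n → ℝ) (EuclideanSpace ℝ (Fin n))
      (ContinuousLinearMap.proj j)).comp (ContinuousLinearMap.proj j)
  have hK : ∀ (p : Fin n → EuclideanSpace ℝ (Fin n)) (f : Fin n → ℝ),
      K p f = ∑ j, f j • p j := by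
    intro p f
    simp [K]
  -- `L y` sends coefficients to the vector they define, read in the trivialization. Coefficients
  -- are recovered by `(L y)⁻¹`, and inversion is smooth at invertible maps.
  let L : M → ((Fin n → ℝ) →L[ℝ] EuclideanSpace ℝ (Fin n)) := fun y ↦ K (fun j ↦ s j y)
  have hL : ContMDiffAt (𝓡 n) 𝓘(ℝ, (Fin n → ℝ) →L[ℝ] EuclideanSpace ℝ (Fin n)) ∞ L x :=
    K.contDiff.contMDiff.contMDiffAt.comp x (contMDiffAt_pi_space.2 hs)
  have hinv : ∀ y ∈ U ∩ e.baseSet, ∃ A : (Fin n → ℝ) ≃L[ℝ] EuclideanSpace ℝ (Fin n),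
      (A : (Fin n → ℝ) →L[ℝ] EuclideanSpace ℝ (Fin n)) = L y := by
    intro y hy
    let φ := e.linearEquivAt ℝ y hy.2
    let A := (((hX.toBasisAt hy.1).equivFun.symm).trans φ).toContinuousLinearEquiv
    refine ⟨A, ?_⟩
    ext1 f
    change φ ((hX.toBasisAt hy.1).equivFun.symm f) = K (fun j ↦ s j y) f
    rw [hK, Basis.equivFun_symm_apply, map_sum]
    refine Finset.sum_congr rfl fun j _ ↦ ?_
    rw [map_smul, hX.toBasisAt_coe]
    rfl
  have hLinv : ContMDiffAt (𝓡 n) 𝓘(ℝ, EuclideanSpace ℝ (Fin n) →L[ℝ] (Fin n → ℝ)) ∞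
      (fun y ↦ ContinuousLinearMap.inverse (L y)) x := by
    obtain ⟨A, hA⟩ := hinv x ⟨hp, hxe⟩
    have h1 : ContDiffAt ℝ ∞ ContinuousLinearMap.inverse (L x) := by
      rw [← hA]
      exact contDiffAt_map_inverse A
    exact h1.contMDiffAt.comp x hL
  have hLinv' : ContMDiffAt ((𝓡 n).prod 𝓘(ℝ, EuclideanSpace ℝ (Fin n)))
      𝓘(ℝ, EuclideanSpace ℝ (Fin n) →L[ℝ] (Fin n → ℝ)) ∞
      (fun q : TangentBundle (𝓡 n) M ↦ ContinuousLinearMap.inverse (L q.1)) ⟨x, v⟩ :=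
    ContMDiffAt.comp (⟨x, v⟩ : TangentBundle (𝓡 n) M) hLinv hproj
  have hfin := (ContinuousLinearMap.proj (R := ℝ) (φ := fun _ : Fin n ↦ ℝ)
    i).contDiff.contMDiff.contMDiffAt.comp _ (hLinv'.clm_apply hq)
  refine hfin.congr_of_eventuallyEq ?_
  have hev : ∀ᶠ q : TangentBundle (𝓡 n) M in 𝓝 ⟨x, v⟩, q.1 ∈ U ∩ e.baseSet :=
    hproj.continuousAt ((hU.inter e.open_baseSet).mem_nhds ⟨hp, hxe⟩)
  filter_upwards [hev] with q hy
  obtain ⟨y, w⟩ := q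
  obtain ⟨A, hA⟩ := hinv y hy
  have hq' : (e ⟨y, w⟩).2 = A (fun j ↦ hX.coeff j y w) := by
    change _ = (A : (Fin n → ℝ) →L[ℝ] EuclideanSpace ℝ (Fin n)) _
    rw [hA]
    change _ = K (fun j ↦ s j y) _
    rw [hK]
    have h1 : w = ∑ j, hX.coeff j y w • X j y := by
      simpa [IsLocalFrameOn.coeff, hy.1] using ((hX.toBasisAt hy.1).sum_repr w).symm
    have := congrArg (e.linearEquivAt ℝ y hy.2) h1
    rw [map_sum] at this
    refine Eq.trans this (Finset.sum_congr rfl fun j _ ↦ ?_)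
    rw [map_smul]
    rfl
  change hX.coeff i y w = ContinuousLinearMap.inverse (L y) (e ⟨y, w⟩).2 i
  rw [← hA, ContinuousLinearMap.inverse_equiv, hq']
  simp

theorem sum_coeff_smul (hX : IsLocalFrameOn (𝓡 n) (EuclideanSpace ℝ (Fin n)) ∞ X U) {x : M}
    (hx : x ∈ U) (w : TangentSpace (𝓡 n) x) : ∑ j, hX.coeff j x w • X j x = w := by
  simpa [IsLocalFrameOn.coeff, hx] using (hX.toBasisAt hx).sum_repr w

theorem coeff_frame (hX : IsLocalFrameOn (𝓡 n) (EuclideanSpace ℝ (Fin n)) ∞ X U) {x : M}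
    (hx : x ∈ U) (j k : Fin n) : hX.coeff k x (X j x) = if j = k then 1 else 0 := by
  rw [IsLocalFrameOn.coeff_apply_of_mem _ hx, ← hX.toBasisAt_coe hx j, Basis.repr_self,
    Finsupp.single_apply]

theorem coeff_sum_smul (hX : IsLocalFrameOn (𝓡 n) (EuclideanSpace ℝ (Fin n)) ∞ X U) {x : M}
    (hx : x ∈ U) (f : Fin n → ℝ) (k : Fin n) : hX.coeff k x (∑ j, f j • X j x) = f k := by
  simp only [map_sum, map_smul, coeff_frame hX hx]
  simp

theorem coeff_parallelismConn (hX : IsLocalFrameOn (𝓡 n) (EuclideanSpace ℝ (Fin n)) ∞ X U) {x : M}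
    (hx : x ∈ U) (σ : (x : M) → TangentSpace (𝓡 n) x) (v : TangentSpace (𝓡 n) x) (k : Fin n) :
    hX.coeff k x (parallelismConn hX σ x v) =
      mvfderiv (𝓡 n) (fun y ↦ hX.coeff k y (σ y)) x v := by
  have h : parallelismConn hX σ x v =
      ∑ j, mvfderiv (𝓡 n) (fun y ↦ hX.coeff j y (σ y)) x v • X j x := by
    simp [parallelismConn]
  rw [h, coeff_sum_smul hX hx]

variable {nabla : ConnOp n M}

theorem tau_apply (hX : IsLocalFrameOn (𝓡 n) (EuclideanSpace ℝ (Fin n)) ∞ X U) (hU : IsOpen U)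
    (hnabla : IsLinearConnectionOn nabla U) {x : M} (hx : x ∈ U)
    {σ : (x : M) → TangentSpace (𝓡 n) x}
    (hσ : MDifferentiableAt (𝓡 n) ((𝓡 n).prod 𝓘(ℝ, EuclideanSpace ℝ (Fin n)))
      (fun y ↦ (⟨y, σ y⟩ : Bundle.TotalSpace (EuclideanSpace ℝ (Fin n))
        (TangentSpace (𝓡 n) (M := M)))) x) (v : TangentSpace (𝓡 n) x) :
    tau hX hU hnabla x v (σ x) = nabla σ x v - parallelismConn hX σ x v := by
  rw [tau, IsCovariantDerivativeOn.difference_apply _ _ hx hσ]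
  rfl

theorem mdifferentiableAt_frame (hX : IsLocalFrameOn (𝓡 n) (EuclideanSpace ℝ (Fin n)) ∞ X U)
    (hU : IsOpen U) {x : M} (hx : x ∈ U) (j : Fin n) :
    MDifferentiableAt (𝓡 n) ((𝓡 n).prod 𝓘(ℝ, EuclideanSpace ℝ (Fin n)))
      (fun y ↦ (⟨y, X j y⟩ : Bundle.TotalSpace (EuclideanSpace ℝ (Fin n))
        (TangentSpace (𝓡 n) (M := M)))) x :=
  (hX.contMDiffAt hU hx j).mdifferentiableAt (by simp)

theorem tau_frame (hX : IsLocalFrameOn (𝓡 n) (EuclideanSpace ℝ (Fin n)) ∞ X U) (hU : IsOpen U)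
    (hnabla : IsLinearConnectionOn nabla U) {x : M} (hx : x ∈ U) (v : TangentSpace (𝓡 n) x)
    (j : Fin n) : tau hX hU hnabla x v (X j x) = nabla (X j) x v := by
  rw [tau_apply hX hU hnabla hx (mdifferentiableAt_frame hX hU hx j),
    parallelismConn_frame hX hU j hx]
  simp

theorem tau_sum_right (hX : IsLocalFrameOn (𝓡 n) (EuclideanSpace ℝ (Fin n)) ∞ X U) (hU : IsOpen U)
    (hnabla : IsLinearConnectionOn nabla U) {x : M} (v : TangentSpace (𝓡 n) x) (f : Fin n → ℝ)
    (w : Fin n → TangentSpace (𝓡 n) x) :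
    tau hX hU hnabla x v (∑ j, f j • w j) = ∑ j, f j • tau hX hU hnabla x v (w j) := by
  simp [tau]

theorem tau_sum_left (hX : IsLocalFrameOn (𝓡 n) (EuclideanSpace ℝ (Fin n)) ∞ X U) (hU : IsOpen U)
    (hnabla : IsLinearConnectionOn nabla U) {x : M} (v : TangentSpace (𝓡 n) x) (f : Fin n → ℝ)
    (w : Fin n → TangentSpace (𝓡 n) x) :
    tau hX hU hnabla x (∑ j, f j • w j) v = ∑ j, f j • tau hX hU hnabla x (w j) v := by
  simp [tau]

/-- The matrix of the endomorphism `τ(v, ·)` in the frame `X₁, …, Xₙ`. -/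
def connMatrix (hX : IsLocalFrameOn (𝓡 n) (EuclideanSpace ℝ (Fin n)) ∞ X U)
    (hU : IsOpen U) (hnabla : IsLinearConnectionOn nabla U) (p : TangentBundle (𝓡 n) M) :
    Matrix (Fin n) (Fin n) ℝ :=
  ∑ i, hX.coeff i p.1 p.2 • tauMatrix hX hU hnabla i p.1

theorem coeff_tau (hX : IsLocalFrameOn (𝓡 n) (EuclideanSpace ℝ (Fin n)) ∞ X U)
    (hU : IsOpen U) (hnabla : IsLinearConnectionOn nabla U) {x : M} (hx : x ∈ U)
    (v w : TangentSpace (𝓡 n) x) (k : Fin n) :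
    hX.coeff k x (tau hX hU hnabla x v w) =
      ∑ j, connMatrix hX hU hnabla ⟨x, v⟩ k j * hX.coeff j x w := by
  conv_lhs => rw [← sum_coeff_smul hX hx v, ← sum_coeff_smul hX hx w, tau_sum_right]
  simp only [tau_sum_left, map_sum, map_smul, smul_eq_mul, connMatrix, Matrix.sum_apply,
    Matrix.smul_apply, tauMatrix, Matrix.of_apply]
  exact Finset.sum_congr rfl fun j _ ↦ mul_comm _ _

theorem contMDiffAt_tauMatrix (hX : IsLocalFrameOn (𝓡 n) (EuclideanSpace ℝ (Fin n)) ∞ X U)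
    (hU : IsOpen U) (hnabla : IsLinearConnectionOn nabla U) {x : M} (hx : x ∈ U) (i k j : Fin n) :
    ContMDiffAt (𝓡 n) 𝓘(ℝ, ℝ) ∞ (fun y ↦ tauMatrix hX hU hnabla i y k j) x := by
  have h1 := (hnabla.smooth.contMDiff (hX.contMDiffOn j)).contMDiffAt (hU.mem_nhds hx)
  have h2 := h1.clm_bundle_apply (hX.contMDiffAt hU hx i)
  have h3 := (contMDiffAt_coeff hX hU ⟨x, nabla (X j) x (X i x)⟩ hx k).comp x h2
  refine h3.congr_of_eventuallyEq ?_
  filter_upwards [hU.mem_nhds hx] with y hy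
  simp only [tauMatrix, Matrix.of_apply, tau_frame hX hU hnabla hy]
  rfl

theorem contMDiffAt_connMatrix (hX : IsLocalFrameOn (𝓡 n) (EuclideanSpace ℝ (Fin n)) ∞ X U)
    (hU : IsOpen U) (hnabla : IsLinearConnectionOn nabla U) (p : TangentBundle (𝓡 n) M)
    (hp : p.1 ∈ U) (k j : Fin n) :
    ContMDiffAt ((𝓡 n).prod 𝓘(ℝ, EuclideanSpace ℝ (Fin n))) 𝓘(ℝ, ℝ) ∞
      (fun q ↦ connMatrix hX hU hnabla q k j) p := by
  simp only [connMatrix, Matrix.sum_apply, Matrix.smul_apply, smul_eq_mul]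
  refine contMDiffAt_finsetSum fun i _ ↦ (contMDiffAt_coeff hX hU p hp i).mul ?_
  exact (contMDiffAt_tauMatrix hX hU hnabla hp i k j).comp p (Bundle.contMDiffAt_proj _)

/-! ### Parallel fields in a smooth local frame -/

omit [IsManifold (𝓡 n) ∞ M] in
theorem hasDerivWithinAt_comp_curve {c : ℝ → M} {J : Set ℝ} {t : ℝ}
    (hc : MDifferentiableWithinAt 𝓘(ℝ, ℝ) (𝓡 n) c J t) {f : M → ℝ}
    (hf : MDifferentiableAt (𝓡 n) 𝓘(ℝ, ℝ) f (c t)) :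
    HasDerivWithinAt (fun r ↦ f (c r)) (mvfderiv (𝓡 n) f (c t) (velocityWithin c J t)) J t := by
  have h := (hf.hasMFDerivAt.comp_hasMFDerivWithinAt t hc.hasMFDerivWithinAt)
  have h2 : HasFDerivWithinAt (fun r ↦ f (c r)) ((mvfderiv (𝓡 n) f (c t)).comp
      (mfderivWithin 𝓘(ℝ, ℝ) (𝓡 n) c J t) : ℝ →L[ℝ] ℝ) J t :=
    hasMFDerivWithinAt_iff_hasFDerivWithinAt.1 h
  exact h2.hasDerivWithinAt

/-- The frame `e` witnessing the covariant derivative is arbitrary, so the coefficients in `X` are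
`∑ⱼ vʲ Xᵏ(eⱼ)`, with `Xᵏ` the coefficient functionals. Their derivative is the `k`-th component of
the covariant derivative for `∇̃`; since the one for `∇ = ∇̃ + τ` vanishes, only `-τ(ċ, V)` remains.
-/
theorem HasCovDerivWithinAt.hasDerivWithinAt_coeff
    (hX : IsLocalFrameOn (𝓡 n) (EuclideanSpace ℝ (Fin n)) ∞ X U)
    (hU : IsOpen U) (hnabla : IsLinearConnectionOn nabla U) {c : ℝ → M} {J : Set ℝ} {t : ℝ}
    (ht : t ∈ J) (hct : c t ∈ U) (hc : MDifferentiableWithinAt 𝓘(ℝ, ℝ) (𝓡 n) c J t)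
    {V : (t : ℝ) → TangentSpace (𝓡 n) (c t)} (hV : HasCovDerivWithinAt nabla c V J t 0)
    (k : Fin n) :
    HasDerivWithinAt (fun r ↦ hX.coeff k (c r) (V r))
      (-hX.coeff k (c t) (tau hX hU hnabla (c t) (velocityWithin c J t) (V t))) J t := by
  obtain ⟨W, e, v, v', hW, hctW, he, hVe, hv, h0⟩ := hV
  have hVt : V t = ∑ j, v j t • e j (c t) := hVe.self_of_nhdsWithin ht
  have hef : ∀ j, MDifferentiableAt (𝓡 n) 𝓘(ℝ, ℝ) (fun y ↦ hX.coeff k y (e j y)) (c t) :=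
    fun j ↦ mdifferentiableAt_coeff hX hU hct (mdifferentiableAt_frame he hW hctW j) k
  have hd : HasDerivWithinAt (fun r ↦ ∑ j, v j r * hX.coeff k (c r) (e j (c r)))
      (∑ j, (v' j * hX.coeff k (c t) (e j (c t)) + v j t *
        mvfderiv (𝓡 n) (fun y ↦ hX.coeff k y (e j y)) (c t) (velocityWithin c J t))) J t :=
    HasDerivWithinAt.fun_sum fun j _ ↦ (hv j).mul (hasDerivWithinAt_comp_curve hc (hef j))
  have hcoeff : ∀ (r : ℝ), V r = ∑ j, v j r • e j (c r) →
      hX.coeff k (c r) (V r) = ∑ j, v j r * hX.coeff k (c r) (e j (c r)) := fun r hr ↦ by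
    rw [hr]; simp
  refine (hd.congr_of_eventuallyEq (hVe.mono hcoeff) (hcoeff t hVt)).congr_deriv ?_
  have h1 := congrArg (hX.coeff k (c t)) h0
  simp only [map_zero, map_sum, map_add, map_smul, smul_eq_mul] at h1
  rw [hVt, tau_sum_right]
  simp only [map_sum, map_smul, smul_eq_mul,
    tau_apply hX hU hnabla hct (mdifferentiableAt_frame he hW hctW _), map_sub,
    coeff_parallelismConn hX hct, mul_sub, Finset.sum_sub_distrib]
  simp only [Finset.sum_add_distrib] at h1 ⊢
  linarith

/-- Converse direction, used to produce parallel fields from solutions of the matrix equation; the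
witnessing frame is `X` itself. -/
theorem hasCovDerivWithinAt_sum_frame
    (hX : IsLocalFrameOn (𝓡 n) (EuclideanSpace ℝ (Fin n)) ∞ X U)
    (hU : IsOpen U) (hnabla : IsLinearConnectionOn nabla U) {c : ℝ → M} {J : Set ℝ} {t : ℝ}
    (hct : c t ∈ U) {v : Fin n → ℝ → ℝ}
    (hv : ∀ k, HasDerivWithinAt (v k)
      (-∑ j, connMatrix hX hU hnabla ⟨c t, velocityWithin c J t⟩ k j * v j t) J t) :
    HasCovDerivWithinAt nabla c (fun r ↦ ∑ j, v j r • X j (c r)) J t 0 := by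
  refine ⟨U, X, v, _, hU, hct, hX, Filter.Eventually.of_forall fun _ ↦ rfl, hv, ?_⟩
  have h1 := tau_sum_right hX hU hnabla (velocityWithin c J t) (fun j ↦ v j t)
    (fun j ↦ X j (c t))
  have h2 := sum_coeff_smul hX hct
    (tau hX hU hnabla (c t) (velocityWithin c J t) (∑ j, v j t • X j (c t)))
  simp only [coeff_tau hX hU hnabla hct, coeff_sum_smul hX hct] at h2
  simp only [tau_frame hX hU hnabla hct] at h1
  rw [Finset.sum_add_distrib, ← h1, ← h2]
  simp

end coefficients

/-! ### Curves with values in matrices -/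

section matrix

attribute [local instance] Matrix.linftyOpNormedRing Matrix.linftyOpNormedAlgebra

variable {n : ℕ}

theorem matrix_eq_sum_smul_single (A : Matrix (Fin n) (Fin n) ℝ) :
    A = ∑ k, ∑ j, A k j • Matrix.single k j (1 : ℝ) := by
  conv_lhs => rw [Matrix.matrix_eq_sum_single A]
  simp

theorem hasDerivWithinAt_matrix {A : ℝ → Matrix (Fin n) (Fin n) ℝ}
    {A' : Matrix (Fin n) (Fin n) ℝ} {J : Set ℝ} {t : ℝ} :
    HasDerivWithinAt A A' J t ↔ ∀ k j, HasDerivWithinAt (fun r ↦ A r k j) (A' k j) J t := by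
  constructor
  · intro h k j
    exact ((Matrix.entryLinearMap ℝ ℝ k j).toContinuousLinearMap.hasFDerivAt (x := A t)
      ).comp_hasDerivWithinAt t h
  · intro h
    have h1 : HasDerivWithinAt (fun r ↦ ∑ k, ∑ j, A r k j • Matrix.single k j (1 : ℝ))
        (∑ k, ∑ j, A' k j • Matrix.single k j (1 : ℝ)) J t :=
      HasDerivWithinAt.fun_sum fun k _ ↦ HasDerivWithinAt.fun_sum fun j _ ↦ (h k j).smul_const _
    simpa only [← matrix_eq_sum_smul_single] using h1

theorem continuousOn_matrix {A : ℝ → Matrix (Fin n) (Fin n) ℝ} {J : Set ℝ}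
    (h : ∀ k j, ContinuousOn (fun r ↦ A r k j) J) : ContinuousOn A J := by
  have h1 : ContinuousOn (fun r ↦ ∑ k, ∑ j, A r k j • Matrix.single k j (1 : ℝ)) J :=
    continuousOn_finsetSum _ fun k _ ↦ continuousOn_finsetSum _ fun j _ ↦
      (h k j).smul continuousOn_const
  simpa only [← matrix_eq_sum_smul_single] using h1

theorem contDiff_matrix {A : ℝ → Matrix (Fin n) (Fin n) ℝ} {m : WithTop ℕ∞}
    (h : ∀ k j, ContDiff ℝ m (fun r ↦ A r k j)) : ContDiff ℝ m A := by
  have h1 : ContDiff ℝ m (fun r ↦ ∑ k, ∑ j, A r k j • Matrix.single k j (1 : ℝ)) :=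
    ContDiff.sum fun k _ ↦ ContDiff.sum fun j _ ↦ (h k j).smul contDiff_const
  simpa only [← matrix_eq_sum_smul_single] using h1

theorem mem_lieAlgebra_iff {G : Subgroup (GL (Fin n) ℝ)} {A : Matrix (Fin n) (Fin n) ℝ} :
    A ∈ lieAlgebra G ↔ A ∈ tangentSubmodule G :=
  mem_tangentSubmodule_iff_exp.symm

end matrix

/-! ### The two implications, and curves with prescribed initial direction -/

section connection

attribute [local instance] Matrix.linftyOpNormedRing Matrix.linftyOpNormedAlgebra

variable {n : ℕ} {M : Type*} [TopologicalSpace M] [ChartedSpace (EuclideanSpace ℝ (Fin n)) M]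
  [IsManifold (𝓡 n) ∞ M] {X : Fin n → (x : M) → TangentSpace (𝓡 n) x} {U : Set M}
  {nabla : ConnOp n M} {G : Subgroup (GL (Fin n) ℝ)}

theorem continuousOn_velocityWithin {c : ℝ → M} {a b : ℝ} (hab : a < b)
    (hc : ContMDiffOn 𝓘(ℝ, ℝ) (𝓡 n) ∞ c (Icc a b)) :
    ContinuousOn (fun t ↦ (⟨c t, velocityWithin c (Icc a b) t⟩ : TangentBundle (𝓡 n) M))
      (Icc a b) := by
  have h1 := hc.continuousOn_tangentMapWithin (by simp) (uniqueDiffOn_Icc hab).uniqueMDiffOn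
  have h2 : Continuous fun t : ℝ ↦ (⟨t, 1⟩ : TangentBundle 𝓘(ℝ, ℝ) ℝ) :=
    (contMDiff_vectorSpace_iff_contDiff (n := 0) (V := fun _ : ℝ ↦ (1 : ℝ))).2
      contDiff_const |>.continuous
  exact h1.comp h2.continuousOn fun t ht ↦ ht

/-- The matrix of `τ(ċ, ·)` is a linear combination of the `τᵢ`, hence tangent to `G`, so
`solution_mem` applies to the coefficient matrix of the transported frame. -/
theorem isGConnectionOn_of_tauMatrix_mem (P : GStructure G M) (hU : IsOpen U)
    (hX : IsLocalFrameOn (𝓡 n) (EuclideanSpace ℝ (Fin n)) ∞ X U)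
    (hXP : ∀ x ∈ U, (fun i ↦ X i x) ∈ P.adapted x) (hnabla : IsLinearConnectionOn nabla U)
    (h : ∀ i : Fin n, ∀ x ∈ U, tauMatrix hX hU hnabla i x ∈ tangentSubmodule G) :
    IsGConnectionOn P nabla U := by
  intro c a b hab hc hcU z z' hz hpar
  choose V hVa hVb hV using hpar
  have hvel := continuousOn_velocityWithin hab hc
  have hsol := solution_mem (G := G) hab.le
    (B := fun t ↦ -connMatrix hX hU hnabla ⟨c t, velocityWithin c (Icc a b) t⟩)
    (A := fun t ↦ Matrix.of fun k i ↦ hX.coeff k (c t) (V i t)) ?_ ?_ ?_ ?_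
  · obtain ⟨u, hu, hub⟩ := hsol
    have h1 : z' = frameMul (fun i ↦ X i (c b)) (u : Matrix (Fin n) (Fin n) ℝ) := by
      funext i
      rw [← hVb i, ← sum_coeff_smul hX (hcU (right_mem_Icc.2 hab.le)) (V i b), hub]
      rfl
    rw [h1]
    exact P.mul_mem (hXP _ (hcU (right_mem_Icc.2 hab.le))) hu
  · refine (continuousOn_matrix fun k j t ht ↦ ?_).neg
    exact ContinuousAt.comp_continuousWithinAt
      (f := fun t ↦ (⟨c t, velocityWithin c (Icc a b) t⟩ : TangentBundle (𝓡 n) M))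
      (contMDiffAt_connMatrix hX hU hnabla ⟨c t, _⟩ (hcU ht) k j).continuousAt (hvel t ht)
  · intro t ht
    exact Submodule.neg_mem _ (Submodule.sum_mem _ fun i _ ↦
      Submodule.smul_mem _ _ (h i _ (hcU ht)))
  · intro t ht
    refine hasDerivWithinAt_matrix.2 fun k i ↦ ?_
    have h1 := (hV i t ht).hasDerivWithinAt_coeff hX hU hnabla ht (hcU ht)
      ((hc t ht).mdifferentiableWithinAt (by simp)) k
    rw [coeff_tau hX hU hnabla (hcU ht)] at h1
    simpa [Matrix.neg_mul, Matrix.mul_apply] using h1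
  · obtain ⟨u, hu, hz'⟩ := P.exists_eq_mul (hXP _ (hcU (left_mem_Icc.2 hab.le))) hz
    refine ⟨u, hu, ?_⟩
    ext k i
    rw [Matrix.of_apply, hVa i, hz']
    exact (coeff_sum_smul hX (hcU (left_mem_Icc.2 hab.le)) (fun k ↦ (u : Matrix _ _ ℝ) k i) k).symm

theorem contMDiffAt_extChartAt_symm (x : M) {y : EuclideanSpace ℝ (Fin n)}
    (hy : y ∈ (extChartAt (𝓡 n) x).target) :
    ContMDiffAt 𝓘(ℝ, EuclideanSpace ℝ (Fin n)) (𝓡 n) ∞ (extChartAt (𝓡 n) x).symm y :=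
  (contMDiffOn_extChartAt_symm x).contMDiffAt ((isOpen_extChartAt_target x).mem_nhds hy)

theorem tangentMap_extChartAt_symm (x : M) (v : TangentSpace (𝓡 n) x) :
    tangentMap 𝓘(ℝ, EuclideanSpace ℝ (Fin n)) (𝓡 n) (extChartAt (𝓡 n) x).symm
      (tangentMap (𝓡 n) 𝓘(ℝ, EuclideanSpace ℝ (Fin n)) (extChartAt (𝓡 n) x) ⟨x, v⟩) = ⟨x, v⟩ := by
  have hφ : MDifferentiableAt (𝓡 n) 𝓘(ℝ, EuclideanSpace ℝ (Fin n)) (extChartAt (𝓡 n) x) x :=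
    (contMDiffAt_extChartAt (n := ∞)).mdifferentiableAt (by simp)
  have hψ := (contMDiffAt_extChartAt_symm (n := n) x (mem_extChartAt_target x)).mdifferentiableAt
    (by simp)
  have hcomp := tangentMap_comp_at (⟨x, v⟩ : TangentBundle (𝓡 n) M) hψ hφ
  refine hcomp.symm.trans ?_
  have heq : ((extChartAt (𝓡 n) x).symm ∘ extChartAt (𝓡 n) x) =ᶠ[𝓝 x] id := by
    filter_upwards [extChartAt_source_mem_nhds (I := 𝓡 n) x] with y hy
    exact (extChartAt (𝓡 n) x).left_inv hy
  generalize ((extChartAt (𝓡 n) x).symm ∘ extChartAt (𝓡 n) x : M → M) = g at heq ⊢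
  refine Bundle.TotalSpace.ext heq.self_of_nhds (heq_of_eq ?_)
  change mfderiv (𝓡 n) (𝓡 n) g x v = v
  rw [heq.mfderiv_eq, mfderiv_id]
  rfl

/-- Every tangent vector at a point of an open set is, up to rescaling, the velocity of a smooth
curve defined for all times and contained in the open set. -/
theorem exists_curve (hU : IsOpen U) {x : M} (hx : x ∈ U) (v : TangentSpace (𝓡 n) x) :
    ∃ c : ℝ → M, ContMDiff 𝓘(ℝ, ℝ) (𝓡 n) ∞ c ∧ (∀ t, c t ∈ U) ∧ ∃ ε : ℝ, ε ≠ 0 ∧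
      tangentMap 𝓘(ℝ, ℝ) (𝓡 n) c ⟨0, 1⟩ = ⟨x, ε • v⟩ := by
  obtain ⟨y, w, hyw⟩ : ∃ y w : EuclideanSpace ℝ (Fin n), y = extChartAt (𝓡 n) x x ∧
      w = mfderiv (𝓡 n) 𝓘(ℝ, EuclideanSpace ℝ (Fin n)) (extChartAt (𝓡 n) x) x v :=
    ⟨_, _, rfl, rfl⟩
  obtain ⟨hy, hw⟩ := hyw
  have hS : (extChartAt (𝓡 n) x).target ∩ (extChartAt (𝓡 n) x).symm ⁻¹' U ∈ 𝓝 y := by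
    rw [hy]
    refine Filter.inter_mem (extChartAt_target_mem_nhds x) ?_
    refine (continuousAt_extChartAt_symm x).preimage_mem_nhds ?_
    rw [extChartAt_to_inv]
    exact hU.mem_nhds hx
  obtain ⟨r, hr, hrS⟩ := Metric.nhds_basis_ball.mem_iff.1 hS
  obtain ⟨ε, hε⟩ : ∃ ε : ℝ, ε = r / (‖w‖ + 1) := ⟨_, rfl⟩
  have hε0 : 0 < ε := by rw [hε]; positivity
  -- The sine keeps the segment in the chart ball for all times while having derivative `1` at `0`;
  -- the choice of `ε` gives `ε * ‖w‖ < r`.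
  obtain ⟨f, hf⟩ : ∃ f : ℝ → EuclideanSpace ℝ (Fin n), f = fun t ↦ y + (ε * Real.sin t) • w :=
    ⟨_, rfl⟩
  have hfc : ContDiff ℝ ∞ f := by rw [hf]; fun_prop
  have hf0 : f 0 = y := by simp [hf]
  have hfd : HasDerivAt f (ε • w) 0 := by
    have h1 := (((Real.hasDerivAt_sin 0).const_mul ε).smul_const w).const_add y
    rwa [Real.cos_zero, mul_one, ← hf] at h1
  have hfS : ∀ t, f t ∈ (extChartAt (𝓡 n) x).target ∩ (extChartAt (𝓡 n) x).symm ⁻¹' U :=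
    fun t ↦ hrS <| by
      rw [mem_ball_iff_norm]
      calc ‖f t - y‖ = ε * |Real.sin t| * ‖w‖ := by
            simp [hf, norm_smul, abs_of_pos hε0]
        _ ≤ ε * 1 * ‖w‖ := by gcongr; exact Real.abs_sin_le_one t
        _ < ε * (‖w‖ + 1) := by linarith
        _ = r := by rw [hε]; field_simp
  have hsymm := fun t ↦ contMDiffAt_extChartAt_symm (n := n) x (hfS t).1
  refine ⟨(extChartAt (𝓡 n) x).symm ∘ f, fun t ↦ (hsymm t).comp t hfc.contMDiff.contMDiffAt,
    fun t ↦ (hfS t).2, ε, hε0.ne', ?_⟩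
  have h2 : tangentMap 𝓘(ℝ, ℝ) 𝓘(ℝ, EuclideanSpace ℝ (Fin n)) f ⟨0, 1⟩ =
      tangentMap (𝓡 n) 𝓘(ℝ, EuclideanSpace ℝ (Fin n)) (extChartAt (𝓡 n) x) ⟨x, ε • v⟩ := by
    refine Bundle.TotalSpace.ext (hf0.trans hy) (heq_of_eq ?_)
    change mfderiv 𝓘(ℝ, ℝ) 𝓘(ℝ, EuclideanSpace ℝ (Fin n)) f 0 (1 : ℝ) =
      mfderiv (𝓡 n) 𝓘(ℝ, EuclideanSpace ℝ (Fin n)) (extChartAt (𝓡 n) x) x (ε • v)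
    rw [map_smul, ← hw, mfderiv_eq_fderiv]
    exact (fderiv_apply_one_eq_deriv (f := f)).trans hfd.deriv
  rw [tangentMap_comp_at (⟨0, 1⟩ : TangentBundle 𝓘(ℝ, ℝ) ℝ)
    ((hsymm 0).mdifferentiableAt (by simp))
    (hfc.contMDiff.contMDiffAt.mdifferentiableAt (by simp)), h2, tangentMap_extChartAt_symm]

/-- The fundamental solution `A` with `A 0 = 1` along a curve in direction `Xᵢ` is shown to take
values in `G` near `0`; its derivative there is a nonzero multiple of `τᵢ(x)`. -/
theorem tauMatrix_mem_of_isGConnectionOn (P : GStructure G M) (hU : IsOpen U)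
    (hX : IsLocalFrameOn (𝓡 n) (EuclideanSpace ℝ (Fin n)) ∞ X U)
    (hXP : ∀ x ∈ U, (fun i ↦ X i x) ∈ P.adapted x) (hnabla : IsLinearConnectionOn nabla U)
    (h : IsGConnectionOn P nabla U) (i : Fin n) {x : M} (hx : x ∈ U) :
    tauMatrix hX hU hnabla i x ∈ tangentSubmodule G := by
  have : CompleteSpace (Matrix (Fin n) (Fin n) ℝ) := FiniteDimensional.complete ℝ _
  obtain ⟨c, hc, hcU, ρ, hρ, hcx⟩ := exists_curve hU hx (X i x)
  let B : ℝ → Matrix (Fin n) (Fin n) ℝ := fun t ↦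
    -connMatrix hX hU hnabla (tangentMap 𝓘(ℝ, ℝ) (𝓡 n) c ⟨t, 1⟩)
  have hB : ContDiff ℝ 2 B := by
    refine (contDiff_matrix fun k j ↦ ?_).neg
    rw [← contMDiff_iff_contDiff]
    intro t
    have h1 : ContMDiff 𝓘(ℝ, ℝ) ((𝓡 n).prod 𝓘(ℝ, EuclideanSpace ℝ (Fin n))) 2
        fun t : ℝ ↦ tangentMap 𝓘(ℝ, ℝ) (𝓡 n) c (⟨t, 1⟩ : TangentBundle 𝓘(ℝ, ℝ) ℝ) :=
      ((hc.contMDiff_tangentMap (m := ∞) (by simp)).of_le (WithTop.coe_le_coe.2 (le_top : (2 : ℕ∞) ≤ ⊤))).comp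
        ((contMDiff_vectorSpace_iff_contDiff (V := fun _ : ℝ ↦ (1 : ℝ))).2 contDiff_const)
    exact ((contMDiffAt_connMatrix hX hU hnabla _ (hcU t) k j).of_le
      (WithTop.coe_le_coe.2 (le_top : (2 : ℕ∞) ≤ ⊤))).comp t h1.contMDiffAt
  have hB0 : B 0 = -(ρ • tauMatrix hX hU hnabla i x) := by
    change -connMatrix hX hU hnabla (tangentMap 𝓘(ℝ, ℝ) (𝓡 n) c ⟨0, 1⟩) = _
    rw [hcx]
    simp only [connMatrix, map_smul, coeff_frame hX hx]
    simp
  have hvel : ∀ {s t r : ℝ}, s < t → r ∈ Icc s t →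
      (⟨c r, velocityWithin c (Icc s t) r⟩ : TangentBundle (𝓡 n) M) =
        tangentMap 𝓘(ℝ, ℝ) (𝓡 n) c ⟨r, 1⟩ := by
    intro s t r hst hr
    rw [velocityWithin, mfderivWithin_eq_mfderiv
      ((uniqueDiffOn_Icc hst).uniqueMDiffOn r hr) (hc.mdifferentiable (by simp) r)]
    rfl
  obtain ⟨ε, hε, A, hA0, hA⟩ := exists_local_solution
    (h := fun A ↦ (ContinuousLinearMap.mul ℝ (Matrix (Fin n) (Fin n) ℝ)).flip A)
    (x₀ := (1 : Matrix (Fin n) (Fin n) ℝ))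
    (ContinuousLinearMap.contDiff _).contDiffAt hB.continuous 0
  simp only [zero_sub, zero_add, ContinuousLinearMap.flip_apply,
    ContinuousLinearMap.mul_apply'] at hA
  -- Picard–Lindelöf only gives differentiability; the equation with `C²` coefficients upgrades it
  -- to the regularity that `tangentSubmodule` asks for.
  have hAd : ContDiffOn ℝ 2 A (Icc (-ε) ε) := by
    refine ODE.contDiffOn_enat_Icc_of_hasDerivWithinAt (n := 2) (f := fun t A ↦ B t * A)
      (u := univ) ?_ hA fun _ _ ↦ mem_univ _
    exact ContDiff.contDiffOn ((hB.comp contDiff_fst).mul contDiff_snd)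
  have hunit : ∀ᶠ t in 𝓝 (0 : ℝ), IsUnit (A t) := by
    have h1 : ContinuousAt A 0 :=
      (hA 0 ⟨by linarith, hε.le⟩).continuousWithinAt.continuousAt
        (Icc_mem_nhds (by linarith) hε)
    refine h1 (Units.isOpen.mem_nhds ?_)
    rw [hA0]
    exact isUnit_one
  obtain ⟨δ', hδ', hδu⟩ := Metric.nhds_basis_closedBall.mem_iff.1 hunit
  rw [Real.closedBall_eq_Icc, zero_sub, zero_add] at hδu
  set δ := min ε δ' with hδ
  have hδ0 : 0 < δ := lt_min hε hδ'
  have hδε : Icc (-δ) δ ⊆ Icc (-ε) ε :=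
    Icc_subset_Icc (by linarith [min_le_left ε δ']) (min_le_left ε δ')
  have hδδ : Icc (-δ) δ ⊆ Icc (-δ') δ' :=
    Icc_subset_Icc (by linarith [min_le_right ε δ']) (min_le_right ε δ')
  have key : ∀ s ∈ Icc (-δ) δ, ∀ t ∈ Icc (-δ) δ, s < t →
      ∃ u ∈ G, (u : Matrix (Fin n) (Fin n) ℝ) = A t * Ring.inverse (A s) := by
    intro s hs t ht hst
    -- Normalizing by `A s` gives the solution equal to `1` at time `s`. Its columns are the
    -- coefficients of the parallel fields starting at `X (c s)`, so `D t` is the matrix of parallel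
    -- transport from `c s` to `c t`.
    set D : ℝ → Matrix (Fin n) (Fin n) ℝ := fun r ↦ A r * Ring.inverse (A s) with hD
    have hDs : D s = 1 := Ring.mul_inverse_cancel _ (hδu (hδδ hs))
    have hsub : Icc s t ⊆ Icc (-ε) ε := (Icc_subset_Icc hs.1 ht.2).trans hδε
    have hDd : ∀ r ∈ Icc s t, HasDerivWithinAt D (B r * D r) (Icc s t) r := fun r hr ↦
      (((hA r (hsub hr)).mono hsub).mul_const _).congr_deriv (mul_assoc _ _ _)
    have h1 := h c s t hst hc.contMDiffOn (fun r _ ↦ hcU r) (fun j ↦ X j (c s))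
      (fun j ↦ ∑ k, D t k j • X k (c t)) (hXP _ (hcU s)) fun j ↦
        ⟨fun r ↦ ∑ k, D r k j • X k (c r), by simp [hDs, Matrix.one_apply], rfl, fun r hr ↦
          hasCovDerivWithinAt_sum_frame hX hU hnabla (hcU r) fun k ↦ ?_⟩
    · obtain ⟨u, hu, hut⟩ := P.exists_eq_mul (hXP _ (hcU t)) h1
      refine ⟨u, hu, ?_⟩
      ext k j
      have h2 := congrArg (hX.coeff k (c t)) (congrFun hut j)
      simp only [frameMul, coeff_sum_smul hX (hcU t)] at h2
      rw [h2.symm]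
    · rw [hvel hst hr]
      simpa [B, Matrix.neg_mul, Matrix.mul_apply] using hasDerivWithinAt_matrix.1 (hDd r hr) k j
  have hAG : ∀ t ∈ Icc (-δ) δ, ∃ u ∈ G, (u : Matrix (Fin n) (Fin n) ℝ) = A t := by
    have h0 : (0 : ℝ) ∈ Icc (-δ) δ := ⟨by linarith, hδ0.le⟩
    intro t ht
    -- Transport runs forward on nondegenerate intervals, so for `t < 0` it is `(A t)⁻¹` that is
    -- found in `G`.
    rcases lt_trichotomy t 0 with hlt | rfl | hlt
    · obtain ⟨u, hu, hut⟩ := key t ht 0 h0 hlt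
      refine ⟨u⁻¹, G.inv_mem hu, ?_⟩
      obtain ⟨a, ha⟩ := hδu (hδδ ht)
      rw [hA0, one_mul, ← ha, Ring.inverse_unit, Units.val_inj] at hut
      rw [hut, inv_inv, ha]
    · exact ⟨1, G.one_mem, by rw [hA0]; rfl⟩
    · simpa [hA0] using key 0 h0 t ht hlt
  have hsin : ∀ t : ℝ, δ * Real.sin t ∈ Icc (-δ) δ := fun t ↦
    ⟨by nlinarith [Real.neg_one_le_sin t], by nlinarith [Real.sin_le_one t]⟩
  have hmem : δ • B 0 ∈ tangentSubmodule G := by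
    -- `A` is controlled only on `[-δ, δ]`; the sine turns it into a curve in `G` defined for all
    -- times, at the cost of the factor `δ` in the velocity.
    refine ⟨fun t ↦ A (δ * Real.sin t), ?_, fun t ↦ hAG _ (hsin t), by simp [hA0], ?_⟩
    · exact hAd.comp_contDiff (by fun_prop) fun t ↦ hδε (hsin t)
    · have h1 : HasDerivAt (fun t : ℝ ↦ δ * Real.sin t) δ 0 := by
        simpa using (Real.hasDerivAt_sin 0).const_mul δ
      have h2 : HasDerivAt A (B 0) (δ * Real.sin 0) := by
        have h3 := (hA 0 ⟨by linarith, hε.le⟩).hasDerivAt (Icc_mem_nhds (by linarith) hε)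
        rw [hA0, mul_one] at h3
        rw [Real.sin_zero, mul_zero]
        exact h3
      exact h2.scomp 0 h1
  rwa [hB0, Submodule.smul_mem_iff _ hδ0.ne', Submodule.neg_mem_iff,
    Submodule.smul_mem_iff _ hρ] at hmem

end connection

end GStruct

end

theorem mainTheorem2 {n : ℕ} (G : Subgroup (GL (Fin n) ℝ))
    {M : Type*} [TopologicalSpace M] [ChartedSpace (EuclideanSpace ℝ (Fin n)) M]
    [IsManifold (𝓡 n) ∞ M] (P : GStruct.GStructure G M)
    (U : Set M) (hU : IsOpen U)
    (X : Fin n → (x : M) → TangentSpace (𝓡 n) x)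
    (hX : IsLocalFrameOn (𝓡 n) (EuclideanSpace ℝ (Fin n)) ∞ X U)
    (hXP : ∀ x ∈ U, (fun i ↦ X i x) ∈ P.adapted x)
    (nabla : GStruct.ConnOp n M) (hnabla : GStruct.IsLinearConnectionOn nabla U) :
    GStruct.IsGConnectionOn P nabla U ↔
      ∀ i : Fin n, ∀ x ∈ U, GStruct.tauMatrix hX hU hnabla i x ∈ GStruct.lieAlgebra G := by
  simp only [GStruct.mem_lieAlgebra_iff]
  exact ⟨fun h i x hx ↦ GStruct.tauMatrix_mem_of_isGConnectionOn P hU hX hXP hnabla h i hx,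
    GStruct.isGConnectionOn_of_tauMatrix_mem P hU hX hXP hnabla⟩
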